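/- Let $q$ be a prime power, let $k\ge 1$ and $v>2k$ be integers, and let $V$ be a vector space of dimension $v$ over a finite field $\mathbb{F}$ of order $q$. Let $qK_{v:k}$ be the $q$-Kneser graph: its vertices are the $k$-dimensional subspaces of $V$, and two of them are adjacent if their intersection is the zero subspace. If $S$ is an independent set of maximum size in $qK_{v:k}$, then there is a $1$-dimensional subspace $L$ of $V$ such that $S$ consists of exactly the $k$-dimensional subspaces of $V$ that contain $L$. -/

import Mathlib

/-- The `k`-subspaces of `V`: the `F`-linear subspaces of dimension `k`. -/
abbrev KSubspace (F V : Type*) [Field F] [AddCommGroup V] [Module F V] (k : ℕ) : Type _ :=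
  {W : Submodule F V // Module.finrank F W = k}

/-- A finite-dimensional space over a finite field has only finitely many `k`-subspaces. -/
instance KSubspace.instFinite (F V : Type*) [Field F] [Finite F] [AddCommGroup V] [Module F V]
    [FiniteDimensional F V] (k : ℕ) : Finite (KSubspace F V k) :=
  haveI : Finite V := Module.finite_of_finite F
  inferInstance

/-- The `q`-Kneser graph of `V`, where `q` is the order of `F`. Its vertices are the `k`-subspaces
of `V`, and two distinct `k`-subspaces are adjacent when their intersection is the zero subspace.
(For `1 ≤ k` two `k`-subspaces with zero intersection are automatically distinct.) -/
def qKneserGraph (F V : Type*) [Field F] [AddCommGroup V] [Module F V] (k : ℕ) :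
    SimpleGraph (KSubspace F V k) where
  Adj α β := α ≠ β ∧ α.1 ⊓ β.1 = ⊥
  symm := ⟨fun _ _ h => ⟨h.1.symm, by rw [inf_comm]; exact h.2⟩⟩
  loopless := ⟨fun _ h => h.1 rfl⟩

/-! Let `A` be the adjacency operator (`kneserSum`). For a function `g` on `k`-subspaces, a
`(k+1)`-subspace `B` and independent `x, y ∈ B`, compare the sums of `g` over the hyperplanes of `B`
through `x` and through `y` (`pencilSum`). Passing to the difference of these sums turns `A` into
`-a` times the operator that sums over all `B'` meeting `B` exactly in `Q = ⟨x, y⟩`, where `a > 0`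
is a count (`pencilSum_kneserSum_sub`). Modulo `Q`, this is the zero-intersection operator on
`(k-1)`-subspaces. Its eigenvalues are at most its degree `d'`, and only constants have all
differences zero (`eq_of_forall_pencilSum_eq`), so on functions of sum zero every eigenvalue of `A`
is at least `-τ`, with `τ = a * d'` (`kneserTau`). This gives the ratio bound without computing the
spectrum.

Stars attain the bound, so the indicator `f` of a maximum independent set `S` makes `A f + τ f`
constant. Its differences are then harmonic for the operator over `Q`, and by the maximum principle
they do not depend on `B`. If some `W ∈ S` avoids both `x` and `y`, a `B` in general position to `W`
shows that the difference is zero. Were there no nonzero vector common to `S`, all differences would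
vanish and `f` would be constant, which is absurd. A common vector puts `S` inside a star, and
maximality gives equality. -/

open Module

/-! ### Extension of isomorphisms, transitivity on flags, subspaces in general position. -/

section LinearAlgebra

variable {F V : Type*} [Field F] [AddCommGroup V] [Module F V]

/-- An isomorphism between subspaces extends to larger subspaces of equal dimension. -/
theorem Submodule.exists_equiv_extending [FiniteDimensional F V] {U U' W W' : Submodule F V}
    (hU : U ≤ W) (hU' : U' ≤ W') (hd : finrank F W = finrank F W') (f : U ≃ₗ[F] U') :
    ∃ g : W ≃ₗ[F] W', ∀ (x : V) (hx : x ∈ U), (g ⟨x, hU hx⟩ : V) = f ⟨x, hx⟩ := by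
  -- Identifying `W'` with `W` through `e` leaves an isomorphism between two subspaces of `W`, to be
  -- extended to an automorphism of `W`.
  let e := LinearEquiv.ofFinrankEq W W' hd
  obtain ⟨g, hg⟩ := Submodule.exists_linearEquiv_restrict_eq
    ((Submodule.submoduleOfEquivOfLe hU) ≪≫ₗ f ≪≫ₗ (Submodule.submoduleOfEquivOfLe hU').symm ≪≫ₗ
      e.symm.submoduleMap (U'.submoduleOf W'))
  refine ⟨g ≪≫ₗ e, fun x hx => ?_⟩
  have h := hg ⟨⟨x, hU hx⟩, hx⟩
  simp only [LinearEquiv.trans_apply, LinearEquiv.submoduleMap_apply] at h ⊢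
  rw [← h]
  simp only [LinearEquiv.apply_symm_apply]
  rfl

theorem Submodule.map_eq_of_equiv [FiniteDimensional F V] {U U' : Submodule F V}
    (f : U ≃ₗ[F] U') (g : V ≃ₗ[F] V) (h : ∀ (x : V) (hx : x ∈ U), g x = f ⟨x, hx⟩) :
    U.map (g : V →ₗ[F] V) = U' := by
  refine Submodule.eq_of_le_of_finrank_eq ?_ ?_
  · rintro _ ⟨x, hx, rfl⟩
    have := (f ⟨x, hx⟩).2
    rw [← h x hx] at this
    exact this
  · rw [LinearEquiv.finrank_map_eq g U, f.finrank_eq]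

/-- The general linear group is transitive on flags of three subspaces of given dimensions. -/
theorem Submodule.exists_equiv_map_flag [FiniteDimensional F V] {U W B U' W' B' : Submodule F V}
    (hUW : U ≤ W) (hWB : W ≤ B) (hUW' : U' ≤ W') (hWB' : W' ≤ B')
    (hU : finrank F U = finrank F U') (hW : finrank F W = finrank F W')
    (hB : finrank F B = finrank F B') :
    ∃ g : V ≃ₗ[F] V, U.map (g : V →ₗ[F] V) = U' ∧ W.map (g : V →ₗ[F] V) = W' ∧
      B.map (g : V →ₗ[F] V) = B' := by
  obtain ⟨f, hf⟩ := Submodule.exists_equiv_extending hUW hUW' hW (LinearEquiv.ofFinrankEq U U' hU)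
  obtain ⟨f', hf'⟩ := Submodule.exists_equiv_extending hWB hWB' hB f
  obtain ⟨g, hg⟩ := Submodule.exists_linearEquiv_restrict_eq f'
  have hg' : ∀ (x : V) (hx : x ∈ B), g x = f' ⟨x, hx⟩ := fun x hx => (hg ⟨x, hx⟩).symm
  refine ⟨g, map_eq_of_equiv (LinearEquiv.ofFinrankEq U U' hU) g fun x hx => ?_,
    map_eq_of_equiv f g fun x hx => ?_, map_eq_of_equiv f' g hg'⟩
  · rw [hg' x (hWB (hUW hx)), hf' x (hUW hx), hf x hx]
  · rw [hg' x (hWB hx), hf' x hx]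

/-- A vector space is not the union of two proper subspaces, over any field. With three subspaces
this would fail over the field of order 2. -/
theorem Submodule.exists_notMem_of_not_le {B U₁ U₂ : Submodule F V} (h₁ : ¬ B ≤ U₁)
    (h₂ : ¬ B ≤ U₂) : ∃ x ∈ B, x ∉ U₁ ∧ x ∉ U₂ := by
  obtain ⟨x, hxB, hx⟩ := SetLike.not_le_iff_exists.mp h₁
  obtain ⟨y, hyB, hy⟩ := SetLike.not_le_iff_exists.mp h₂
  by_cases hx2 : x ∈ U₂
  · by_cases hy1 : y ∈ U₁
    · exact ⟨x + y, B.add_mem hxB hyB, fun h => hx ((U₁.add_mem_iff_left hy1).mp h),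
        fun h => hy ((U₂.add_mem_iff_right hx2).mp h)⟩
    · exact ⟨y, hyB, hy1, hy⟩
  · exact ⟨x, hxB, hx, hx2⟩

theorem Submodule.not_le_of_finrank_lt [FiniteDimensional F V] {U W : Submodule F V}
    (h : finrank F U < finrank F W) : ¬ W ≤ U := fun hle =>
  absurd (Submodule.finrank_mono hle) (by omega)

/-- Two subspaces of dimension at most `d` are avoided by a common `m`-subspace of any given
subspace of dimension at least `d + m`. -/
theorem Submodule.exists_disjoint_pair [FiniteDimensional F V] (U₁ U₂ B : Submodule F V) (m : ℕ)
    (h₁ : finrank F U₁ + m ≤ finrank F B) (h₂ : finrank F U₂ + m ≤ finrank F B) :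
    ∃ X ≤ B, finrank F X = m ∧ X ⊓ U₁ = ⊥ ∧ X ⊓ U₂ = ⊥ := by
  induction m with
  | zero => exact ⟨⊥, by simp⟩
  | succ m ih =>
    obtain ⟨X, hXB, hX, hX₁, hX₂⟩ := ih (by omega) (by omega)
    have key : ∀ U : Submodule F V, finrank F U + (m + 1) ≤ finrank F B → ¬ B ≤ U ⊔ X := by
      intro U hU
      apply Submodule.not_le_of_finrank_lt
      have := Submodule.finrank_add_le_finrank_add_finrank U X
      omega
    obtain ⟨x, hxB, hx₁, hx₂⟩ := Submodule.exists_notMem_of_not_le (key U₁ h₁) (key U₂ h₂)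
    have key2 : ∀ U : Submodule F V, X ⊓ U = ⊥ → x ∉ U ⊔ X → (X ⊔ F ∙ x) ⊓ U = ⊥ := by
      intro U hXU hx
      rw [Submodule.eq_bot_iff]
      rintro z ⟨hz, hzU⟩
      obtain ⟨y, hy, w, hw, rfl⟩ := Submodule.mem_sup.mp hz
      obtain ⟨c, rfl⟩ := Submodule.mem_span_singleton.mp hw
      have hc : c = 0 := by
        by_contra hc
        apply hx
        have : c • x ∈ U ⊔ X := by
          have := (U ⊔ X).sub_mem (Submodule.mem_sup_left hzU) (Submodule.mem_sup_right hy)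
          simpa using this
        exact (Submodule.smul_mem_iff _ hc).mp this
      subst hc
      have : y ∈ X ⊓ U := ⟨hy, by simpa using hzU⟩
      rw [hXU, Submodule.mem_bot] at this
      simp [this]
    refine ⟨X ⊔ F ∙ x, sup_le hXB ((Submodule.span_singleton_le_iff_mem x B).mpr hxB), ?_,
      key2 U₁ hX₁ hx₁, key2 U₂ hX₂ hx₂⟩
    rw [Submodule.finrank_sup_span_singleton fun h => hx₁ (Submodule.mem_sup_right h), hX]

/-- A common subspace `Q` of `U₁` and `U₂` extends, inside `B`, to a larger subspace that meets both
exactly in `Q`. -/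
theorem Submodule.exists_inf_eq_pair [FiniteDimensional F V] (Q U₁ U₂ B : Submodule F V) (m : ℕ)
    (hQ : Q ≤ B) (hQ₁ : Q ≤ U₁) (hQ₂ : Q ≤ U₂)
    (h₁ : finrank F U₁ + m ≤ finrank F B) (h₂ : finrank F U₂ + m ≤ finrank F B) :
    ∃ X ≤ B, finrank F X = finrank F Q + m ∧ X ⊓ U₁ = Q ∧ X ⊓ U₂ = Q := by
  obtain ⟨X, hXB, hX, hX₁, hX₂⟩ := Submodule.exists_disjoint_pair U₁ U₂ B m h₁ h₂
  refine ⟨Q ⊔ X, sup_le hQ hXB, ?_, ?_, ?_⟩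
  · have h := Submodule.finrank_sup_add_finrank_inf_eq Q X
    have h0 : Q ⊓ X = ⊥ := by
      rw [eq_bot_iff, ← hX₁, inf_comm]
      exact inf_le_inf_left X hQ₁
    rw [h0, finrank_bot] at h
    omega
  · rw [sup_inf_assoc_of_le X hQ₁, hX₁, sup_bot_eq]
  · rw [sup_inf_assoc_of_le X hQ₂, hX₂, sup_bot_eq]

theorem Submodule.finrank_span_pair [FiniteDimensional F V] {x y : V} (hx : x ≠ 0)
    (hy : y ∉ F ∙ x) : finrank F (F ∙ x ⊔ F ∙ y : Submodule F V) = 2 := by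
  rw [Submodule.finrank_sup_span_singleton hy, finrank_span_singleton hx]

theorem Submodule.inf_span_pair_eq_iff {C : Submodule F V} {x z : V} (hz : z ∉ F ∙ x) :
    C ⊓ (F ∙ x ⊔ F ∙ z) = F ∙ x ↔ x ∈ C ∧ z ∉ C := by
  constructor
  · intro h
    have hx : x ∈ C ⊓ (F ∙ x ⊔ F ∙ z) := h.ge (Submodule.mem_span_singleton_self x)
    refine ⟨hx.1, fun hzC => hz ?_⟩
    rw [← h]
    exact ⟨hzC, Submodule.mem_sup_right (Submodule.mem_span_singleton_self z)⟩
  · rintro ⟨hx, hzC⟩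
    have hxC : F ∙ x ≤ C := (Submodule.span_singleton_le_iff_mem x C).mpr hx
    have hz0 : z ≠ 0 := fun h => hz (h ▸ Submodule.zero_mem _)
    rw [inf_comm, sup_inf_assoc_of_le _ hxC, inf_comm,
      ((Submodule.disjoint_span_singleton' hz0).mpr hzC).eq_bot, sup_bot_eq]

/-- The modular law gives `C ⊓ (W ⊔ F ∙ x) = F ∙ x ⊔ (C ⊓ W)`. This makes "through `x` and avoiding
`W`" a flag condition. -/
theorem Submodule.inf_sup_span_singleton_eq_iff {C W : Submodule F V} {x : V} (hxC : x ∈ C)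
    (hxW : x ∉ W) : C ⊓ (W ⊔ F ∙ x) = F ∙ x ↔ C ⊓ W = ⊥ := by
  have hx0 : x ≠ 0 := fun h => hxW (h ▸ W.zero_mem)
  have hx : F ∙ x ≤ C := (Submodule.span_singleton_le_iff_mem x C).mpr hxC
  rw [inf_comm, sup_comm, sup_inf_assoc_of_le _ hx, inf_comm W]
  constructor
  · intro h
    have h1 : C ⊓ W ≤ F ∙ x := h ▸ le_sup_right
    rw [eq_bot_iff, ← ((Submodule.disjoint_span_singleton' hx0).mpr hxW).eq_bot]
    exact le_inf inf_le_right h1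
  · intro h
    rw [h, sup_bot_eq]

end LinearAlgebra

/-! ### Counts that depend only on the dimensions of a flag. -/

section Counting

open scoped Classical
attribute [local instance] Fintype.ofFinite

variable {F V : Type*} [Field F] [Finite F] [AddCommGroup V] [Module F V] [FiniteDimensional F V]

theorem KSubspace.card_flag_le (m : ℕ) {U W B U' W' B' : Submodule F V}
    (hUW : U ≤ W) (hWB : W ≤ B) (hUW' : U' ≤ W') (hWB' : W' ≤ B')
    (hU : finrank F U = finrank F U') (hW : finrank F W = finrank F W')
    (hB : finrank F B = finrank F B') :
    Finset.card {C : KSubspace F V m | C.1 ⊓ W = U ∧ C.1 ≤ B} ≤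
      Finset.card {C : KSubspace F V m | C.1 ⊓ W' = U' ∧ C.1 ≤ B'} := by
  obtain ⟨g, rfl, rfl, rfl⟩ := Submodule.exists_equiv_map_flag hUW hWB hUW' hWB' hU hW hB
  refine Finset.card_le_card_of_injOn
    (fun C => ⟨C.1.map (g : V →ₗ[F] V), (LinearEquiv.finrank_map_eq g C.1).trans C.2⟩) ?_ ?_
  · intro C hC
    simp only [Finset.coe_filter, Finset.mem_univ, true_and, Set.mem_ofPred_eq] at hC ⊢
    refine ⟨?_, Submodule.map_mono hC.2⟩
    rw [← Submodule.map_inf _ g.injective, hC.1]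
  · intro C _ D _ h
    simp only [Subtype.mk.injEq] at h
    exact Subtype.ext (Submodule.map_injective_of_injective g.injective h)

variable (F V) in
theorem KSubspace.exists_flagCount :
    ∃ N : ℕ → ℕ → ℕ → ℕ → ℕ, ∀ (m : ℕ) (U W B : Submodule F V), U ≤ W → W ≤ B →
      Finset.card {C : KSubspace F V m | C.1 ⊓ W = U ∧ C.1 ≤ B} =
        N m (finrank F U) (finrank F W) (finrank F B) := by
  -- The count is read off from a chosen flag of the given dimensions; the value 0 for dimensions
  -- that no flag has is never used.
  refine ⟨fun m u w b => if h : ∃ X : Submodule F V × Submodule F V × Submodule F V,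
      (X.1 ≤ X.2.1 ∧ X.2.1 ≤ X.2.2) ∧
      finrank F X.1 = u ∧ finrank F X.2.1 = w ∧ finrank F X.2.2 = b then
      Finset.card {C : KSubspace F V m | C.1 ⊓ h.choose.2.1 = h.choose.1 ∧ C.1 ≤ h.choose.2.2}
      else 0, fun m U W B hUW hWB => ?_⟩
  have h : ∃ X : Submodule F V × Submodule F V × Submodule F V, (X.1 ≤ X.2.1 ∧ X.2.1 ≤ X.2.2) ∧
      finrank F X.1 = finrank F U ∧ finrank F X.2.1 = finrank F W ∧
      finrank F X.2.2 = finrank F B := ⟨(U, W, B), ⟨hUW, hWB⟩, rfl, rfl, rfl⟩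
  obtain ⟨⟨h1, h2⟩, h3, h4, h5⟩ := h.choose_spec
  refine Eq.trans ?_ (dif_pos h).symm
  exact le_antisymm (card_flag_le m hUW hWB h1 h2 h3.symm h4.symm h5.symm)
    (card_flag_le m h1 h2 hUW hWB h3 h4 h5)

variable (F V) in
/-- For subspaces `U ≤ W ≤ B` of dimensions `u`, `w`, `b`, the number of `m`-subspaces of `B` that
meet `W` exactly in `U`. -/
noncomputable def KSubspace.flagCount : ℕ → ℕ → ℕ → ℕ → ℕ :=
  (KSubspace.exists_flagCount F V).choose

theorem KSubspace.card_flag (m : ℕ) {U W B : Submodule F V} (hUW : U ≤ W) (hWB : W ≤ B) :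
    Finset.card {C : KSubspace F V m | C.1 ⊓ W = U ∧ C.1 ≤ B} =
      flagCount F V m (finrank F U) (finrank F W) (finrank F B) :=
  (KSubspace.exists_flagCount F V).choose_spec m U W B hUW hWB

theorem KSubspace.card_inf_eq (m : ℕ) {U W : Submodule F V} (hUW : U ≤ W) :
    Finset.card {C : KSubspace F V m | C.1 ⊓ W = U} =
      flagCount F V m (finrank F U) (finrank F W) (finrank F V) := by
  rw [← finrank_top F V, ← card_flag m hUW le_top]
  simp

theorem KSubspace.card_mem_le {m b : ℕ} {x : V} {B : Submodule F V} (hx : x ≠ 0) (hxB : x ∈ B)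
    (hB : finrank F B = b) :
    Finset.card {C : KSubspace F V m | x ∈ C.1 ∧ C.1 ≤ B} = flagCount F V m 1 1 b := by
  have h := card_flag m (le_refl (F ∙ x)) ((Submodule.span_singleton_le_iff_mem x B).mpr hxB)
  rw [finrank_span_singleton hx, hB] at h
  rw [← h]
  simp

theorem KSubspace.card_mem_notMem_le {m b : ℕ} {x z : V} {B : Submodule F V} (hx : x ≠ 0)
    (hz : z ∉ F ∙ x) (hxB : x ∈ B) (hzB : z ∈ B) (hB : finrank F B = b) :
    Finset.card {C : KSubspace F V m | (x ∈ C.1 ∧ z ∉ C.1) ∧ C.1 ≤ B} =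
      flagCount F V m 1 2 b := by
  have h := card_flag (B := B) m (le_sup_left : F ∙ x ≤ F ∙ x ⊔ F ∙ z)
    (sup_le ((Submodule.span_singleton_le_iff_mem x B).mpr hxB)
      ((Submodule.span_singleton_le_iff_mem z B).mpr hzB))
  rw [finrank_span_singleton hx, hB, Submodule.finrank_span_pair hx hz] at h
  rw [← h]
  simp only [Submodule.inf_span_pair_eq_iff hz]

theorem KSubspace.card_mem_inf_eq_bot {m w : ℕ} {x : V} {W : Submodule F V} (hxW : x ∉ W)
    (hW : finrank F W = w) :
    Finset.card {C : KSubspace F V m | x ∈ C.1 ∧ C.1 ⊓ W = ⊥} =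
      flagCount F V m 1 (w + 1) (finrank F V) := by
  have hx0 : x ≠ 0 := fun h => hxW (h ▸ W.zero_mem)
  have h := card_inf_eq m (le_sup_right : F ∙ x ≤ W ⊔ F ∙ x)
  rw [finrank_span_singleton hx0, Submodule.finrank_sup_span_singleton hxW, hW] at h
  rw [← h]
  congr 1
  ext C
  simp only [Finset.mem_filter, Finset.mem_univ, true_and]
  constructor
  · rintro ⟨h1, h2⟩
    exact (Submodule.inf_sup_span_singleton_eq_iff h1 hxW).mpr h2
  · intro h2
    have h1 : x ∈ C.1 := by
      have : x ∈ C.1 ⊓ (W ⊔ F ∙ x) := h2.ge (Submodule.mem_span_singleton_self x)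
      exact this.1
    exact ⟨h1, (Submodule.inf_sup_span_singleton_eq_iff h1 hxW).mp h2⟩

theorem KSubspace.flagCount_pos {k : ℕ} {x z : V} {B : Submodule F V} (hk : 1 ≤ k) (hx : x ≠ 0)
    (hz : z ∉ F ∙ x) (hxB : x ∈ B) (hzB : z ∈ B) (hB : finrank F B = k + 1) :
    0 < flagCount F V k 1 2 (k + 1) := by
  rw [← card_mem_notMem_le hx hz hxB hzB hB, Finset.card_pos]
  have h2 := Submodule.finrank_span_pair hx hz
  obtain ⟨X, hXB, hX, hXQ, -⟩ := Submodule.exists_inf_eq_pair (F ∙ x) (F ∙ x ⊔ F ∙ z)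
    (F ∙ x ⊔ F ∙ z) B (k - 1) ((Submodule.span_singleton_le_iff_mem x B).mpr hxB)
    le_sup_left le_sup_left (by omega) (by omega)
  rw [finrank_span_singleton hx] at hX
  refine ⟨⟨X, by omega⟩, ?_⟩
  simp only [Finset.mem_filter, Finset.mem_univ, true_and]
  exact ⟨(Submodule.inf_span_pair_eq_iff hz).mp hXQ, hXB⟩

end Counting

/-! ### The intertwining identity between the two zero-intersection operators. -/

section Intertwining

open scoped Classical
attribute [local instance] Fintype.ofFinite

variable {F V : Type*} [Field F] [Finite F] [AddCommGroup V] [Module F V] [FiniteDimensional F V]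
  {k : ℕ}

namespace KSubspace

/-- The sum of `g` over the `k`-subspaces that meet `W` trivially. -/
noncomputable def kneserSum (g : KSubspace F V k → ℝ) (W : Submodule F V) : ℝ :=
  ∑ C : KSubspace F V k with C.1 ⊓ W = ⊥, g C

/-- The sum of `g` over the `k`-subspaces between the vector `x` and the subspace `B`. -/
noncomputable def pencilSum (g : KSubspace F V k → ℝ) (x : V) (B : Submodule F V) : ℝ :=
  ∑ C : KSubspace F V k with x ∈ C.1 ∧ C.1 ≤ B, g C

theorem pencilSum_kneserSum (g : KSubspace F V k → ℝ) (x : V) (B : Submodule F V) :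
    pencilSum (fun W : KSubspace F V k => kneserSum g W.1) x B =
      ∑ C : KSubspace F V k, g C *
        (Finset.card {W : KSubspace F V k | (x ∈ W.1 ∧ W.1 ≤ B) ∧ C.1 ⊓ W.1 = ⊥} : ℝ) := by
  unfold pencilSum kneserSum
  rw [Finset.sum_comm' (t' := Finset.univ)
    (s' := fun C => {W : KSubspace F V k | (x ∈ W.1 ∧ W.1 ≤ B) ∧ C.1 ⊓ W.1 = ⊥})
    (by intro W C; simp)]
  refine Finset.sum_congr rfl fun C _ => ?_
  rw [Finset.sum_const, nsmul_eq_mul, mul_comm]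

theorem sum_pencilSum (g : KSubspace F V k → ℝ) (x : V) (B Q : Submodule F V) :
    ∑ B' : KSubspace F V (k + 1) with B'.1 ⊓ B = Q, pencilSum g x B'.1 =
      ∑ C : KSubspace F V k, g C *
        (Finset.card {B' : KSubspace F V (k + 1) | B'.1 ⊓ B = Q ∧ x ∈ C.1 ∧ C.1 ≤ B'.1} : ℝ) := by
  unfold pencilSum
  rw [Finset.sum_comm' (t' := Finset.univ)
    (s' := fun C => {B' : KSubspace F V (k + 1) | B'.1 ⊓ B = Q ∧ x ∈ C.1 ∧ C.1 ≤ B'.1})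
    (by intro W C; simp)]
  refine Finset.sum_congr rfl fun C _ => ?_
  rw [Finset.sum_const, nsmul_eq_mul, mul_comm]

omit [Finite F] in
theorem inf_eq_span_singleton {C B : Submodule F V} {x : V} (hx : x ≠ 0)
    (h : finrank F (C ⊓ B : Submodule F V) = 1) (hxC : x ∈ C) (hxB : x ∈ B) :
    C ⊓ B = F ∙ x :=
  (Submodule.eq_of_le_of_finrank_eq
    ((Submodule.span_singleton_le_iff_mem x (C ⊓ B)).mpr ⟨hxC, hxB⟩)
    (by rw [h, finrank_span_singleton hx])).symm

/-- Hyperplanes of `B` through `x` that avoid `C`, when `C` does not meet `B` in a point. -/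
theorem card_mem_le_inf_eq_bot_of_finrank_ne_one {B : KSubspace F V (k + 1)} {C : Submodule F V}
    {x : V} (hx : x ≠ 0) (hxB : x ∈ B.1) (h : finrank F (C ⊓ B.1 : Submodule F V) ≠ 1) :
    Finset.card {W : KSubspace F V k | (x ∈ W.1 ∧ W.1 ≤ B.1) ∧ C ⊓ W.1 = ⊥} =
      if C ⊓ B.1 = ⊥ then flagCount F V k 1 1 (k + 1) else 0 := by
  split_ifs with h0
  · rw [← card_mem_le hx hxB B.2]
    congr 1
    ext W
    simp only [Finset.mem_filter, Finset.mem_univ, true_and, and_iff_left_iff_imp]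
    rintro ⟨-, hW⟩
    rw [eq_bot_iff, ← h0]
    exact inf_le_inf_left C hW
  · rw [Finset.card_eq_zero, Finset.filter_eq_empty_iff]
    rintro W - ⟨⟨-, hW⟩, hCW⟩
    -- Here `C ⊓ B` has dimension at least 2, so it meets every hyperplane of `B`.
    have h1 : finrank F (C ⊓ B.1 : Submodule F V) ≠ 0 := by
      rwa [Ne, Submodule.finrank_eq_zero]
    have h2 := Submodule.finrank_sup_add_finrank_inf_eq (C ⊓ B.1) W.1
    have h3 : C ⊓ B.1 ⊓ W.1 = ⊥ := by
      rw [eq_bot_iff, ← hCW]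
      exact inf_le_inf_right _ inf_le_left
    have h4 := Submodule.finrank_mono (sup_le (inf_le_right : C ⊓ B.1 ≤ B.1) hW)
    rw [h3, finrank_bot, W.2] at h2
    rw [B.2] at h4
    omega

/-- Hyperplanes of `B` through `x` that avoid `C`, when `C` meets `B` in a point. -/
theorem card_mem_le_inf_eq_bot_of_finrank_eq_one {B : KSubspace F V (k + 1)} {C : Submodule F V}
    {x : V} (hx : x ≠ 0) (hxB : x ∈ B.1) (h : finrank F (C ⊓ B.1 : Submodule F V) = 1) :
    Finset.card {W : KSubspace F V k | (x ∈ W.1 ∧ W.1 ≤ B.1) ∧ C ⊓ W.1 = ⊥} =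
      if C ⊓ B.1 = F ∙ x then 0 else flagCount F V k 1 2 (k + 1) := by
  split_ifs with h0
  · rw [Finset.card_eq_zero, Finset.filter_eq_empty_iff]
    rintro W - ⟨⟨hxW, -⟩, hCW⟩
    have hxC : x ∈ C := (h0.ge (Submodule.mem_span_singleton_self x)).1
    exact hx ((Submodule.mem_bot F).mp (hCW.le ⟨hxC, hxW⟩))
  · obtain ⟨z, hz0, hz⟩ : ∃ z ≠ 0, C ⊓ B.1 = F ∙ z := by
      obtain ⟨z, hz, hz0⟩ := Submodule.exists_mem_ne_zero_of_ne_bot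
        (p := C ⊓ B.1) (fun h' => by rw [h', finrank_bot] at h; omega)
      exact ⟨z, hz0, inf_eq_span_singleton hz0 h hz.1 hz.2⟩
    have hzmem := hz.ge (Submodule.mem_span_singleton_self z)
    have hzx : z ∉ F ∙ x := by
      intro hzx
      apply h0
      rw [hz]
      exact Submodule.eq_of_le_of_finrank_eq ((Submodule.span_singleton_le_iff_mem z _).mpr hzx)
        (by rw [finrank_span_singleton hx, finrank_span_singleton hz0])
    rw [← card_mem_notMem_le hx hzx hxB hzmem.2 B.2]
    congr 1
    ext W
    simp only [Finset.mem_filter, Finset.mem_univ, true_and]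
    rw [and_assoc, and_assoc, and_congr_right_iff]
    intro _
    rw [and_comm, and_congr_left_iff]
    intro hWB
    -- Inside `B` only the point `⟨z⟩` of `C` is visible, so `W` avoids `C` exactly when it misses
    -- `z`.
    have : C ⊓ W.1 = W.1 ⊓ F ∙ z := by
      rw [← hz, inf_comm W.1, inf_assoc, inf_eq_right.mpr hWB]
    rw [this, ← disjoint_iff, Submodule.disjoint_span_singleton' hz0]

/-- The `(k+1)`-subspaces that contain `C` and meet `B` in the line through `x` and `y`. -/
theorem card_inf_eq_le {B : KSubspace F V (k + 1)} {C : KSubspace F V k} {x y : V}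
    (hxB : x ∈ B.1) (hyB : y ∈ B.1) (hyC : y ∉ C.1) :
    Finset.card {B' : KSubspace F V (k + 1) | B'.1 ⊓ B.1 = F ∙ x ⊔ F ∙ y ∧ x ∈ C.1 ∧ C.1 ≤ B'.1} =
      if C.1 ⊓ B.1 = F ∙ x then 1 else 0 := by
  have hy0 : y ≠ 0 := fun h => hyC (h ▸ C.1.zero_mem)
  have hfr := Submodule.finrank_sup_span_singleton hyC
  rw [C.2] at hfr
  split_ifs with h0
  · have hxC : x ∈ C.1 := (h0.ge (Submodule.mem_span_singleton_self x)).1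
    rw [Finset.card_eq_one]
    -- A `(k+1)`-subspace containing both `C` and `y ∉ C` must be their span.
    refine ⟨⟨C.1 ⊔ F ∙ y, hfr⟩, ?_⟩
    ext B'
    simp only [Finset.mem_filter, Finset.mem_univ, true_and, Finset.mem_singleton]
    constructor
    · rintro ⟨h1, -, h2⟩
      have hyB' : y ∈ B'.1 := (h1.ge (Submodule.mem_sup_right
        (Submodule.mem_span_singleton_self y))).1
      exact Subtype.ext (Submodule.eq_of_le_of_finrank_eq
        (sup_le h2 ((Submodule.span_singleton_le_iff_mem y _).mpr hyB'))
        (by rw [hfr, B'.2])).symm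
    · rintro rfl
      refine ⟨?_, hxC, le_sup_left⟩
      change (C.1 ⊔ F ∙ y) ⊓ B.1 = _
      rw [sup_comm, sup_inf_assoc_of_le _ ((Submodule.span_singleton_le_iff_mem y _).mpr hyB),
        h0, sup_comm]
  · rw [Finset.card_eq_zero, Finset.filter_eq_empty_iff]
    rintro B' - ⟨h1, hxC, h2⟩
    apply h0
    refine le_antisymm ?_ ((Submodule.span_singleton_le_iff_mem x _).mpr ⟨hxC, hxB⟩)
    have h3 : C.1 ⊓ B.1 ≤ C.1 ⊓ (F ∙ x ⊔ F ∙ y) := by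
      rw [← h1]
      exact le_inf inf_le_left (inf_le_inf_right _ h2)
    refine h3.trans ?_
    rw [inf_comm, sup_inf_assoc_of_le _ ((Submodule.span_singleton_le_iff_mem x _).mpr hxC),
      inf_comm, ((Submodule.disjoint_span_singleton' hy0).mpr hyC).eq_bot, sup_bot_eq]

theorem card_inf_eq_le_of_notMem {B : KSubspace F V (k + 1)} {C : KSubspace F V k} {x : V}
    (Q : Submodule F V) (hxC : x ∉ C.1) :
    Finset.card {B' : KSubspace F V (k + 1) | B'.1 ⊓ B.1 = Q ∧ x ∈ C.1 ∧ C.1 ≤ B'.1} = 0 := by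
  simp [hxC]

/-- This is the intertwining identity for the coefficient of a single `C`. Both sides equal `-a`
times `[C ⊓ B = ⟨x⟩] - [C ⊓ B = ⟨y⟩]`: unless `C ⊓ B` is a point, the counts on the left do not
depend on the vector. If `C` contains both `x` and `y`, the two counts on the right coincide. -/
theorem card_pencil_sub_card_pencil {B : KSubspace F V (k + 1)} (C : KSubspace F V k) {x y : V}
    (hx : x ≠ 0) (hy : y ∉ F ∙ x) (hxB : x ∈ B.1) (hyB : y ∈ B.1) :
    (Finset.card {W : KSubspace F V k | (x ∈ W.1 ∧ W.1 ≤ B.1) ∧ C.1 ⊓ W.1 = ⊥} : ℝ) -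
      Finset.card {W : KSubspace F V k | (y ∈ W.1 ∧ W.1 ≤ B.1) ∧ C.1 ⊓ W.1 = ⊥} =
    -(flagCount F V k 1 2 (k + 1) : ℝ) *
      ((Finset.card {B' : KSubspace F V (k + 1) |
          B'.1 ⊓ B.1 = F ∙ x ⊔ F ∙ y ∧ x ∈ C.1 ∧ C.1 ≤ B'.1} : ℝ) -
        Finset.card {B' : KSubspace F V (k + 1) |
          B'.1 ⊓ B.1 = F ∙ x ⊔ F ∙ y ∧ y ∈ C.1 ∧ C.1 ≤ B'.1}) := by
  have hy0 : y ≠ 0 := fun h => hy (h ▸ Submodule.zero_mem _)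
  have hxy : x ∉ F ∙ y := by
    intro h
    obtain ⟨c, rfl⟩ := Submodule.mem_span_singleton.mp h
    have hc : c ≠ 0 := fun h => hx (by simp [h])
    exact hy ((Submodule.smul_mem_iff _ hc).mp (Submodule.mem_span_singleton_self _))
  have hne : F ∙ x ≠ F ∙ y := fun h => hy (h ▸ Submodule.mem_span_singleton_self y)
  have psix : y ∉ C.1 → _ := fun h => card_inf_eq_le (B := B) (C := C) (x := x) hxB hyB h
  have psiy : x ∉ C.1 → _ := fun h => card_inf_eq_le (B := B) (C := C) (x := y) hyB hxB h
  rw [sup_comm] at psiy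
  by_cases h1 : finrank F (C.1 ⊓ B.1 : Submodule F V) = 1
  · rw [card_mem_le_inf_eq_bot_of_finrank_eq_one hx hxB h1,
      card_mem_le_inf_eq_bot_of_finrank_eq_one hy0 hyB h1]
    by_cases hxC : x ∈ C.1
    · have hX := inf_eq_span_singleton hx h1 hxC hxB
      have hyC : y ∉ C.1 := fun hyC => hne (hX.symm.trans (inf_eq_span_singleton hy0 h1 hyC hyB))
      rw [psix hyC, card_inf_eq_le_of_notMem _ hyC, hX, if_pos rfl, if_neg hne, if_pos rfl]
      simp
    · have hX : C.1 ⊓ B.1 ≠ F ∙ x :=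
        fun h => hxC (h.ge (Submodule.mem_span_singleton_self x)).1
      rw [psiy hxC, card_inf_eq_le_of_notMem _ hxC, if_neg hX]
      split_ifs <;> simp
  · have hX : C.1 ⊓ B.1 ≠ F ∙ x := fun h => h1 (by rw [h, finrank_span_singleton hx])
    have hY : C.1 ⊓ B.1 ≠ F ∙ y := fun h => h1 (by rw [h, finrank_span_singleton hy0])
    rw [card_mem_le_inf_eq_bot_of_finrank_ne_one hx hxB h1,
      card_mem_le_inf_eq_bot_of_finrank_ne_one hy0 hyB h1, sub_self]
    by_cases hxC : x ∈ C.1 <;> by_cases hyC : y ∈ C.1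
    · simp [hxC, hyC]
    · rw [psix hyC, card_inf_eq_le_of_notMem _ hyC, if_neg hX]
      simp
    · rw [psiy hxC, card_inf_eq_le_of_notMem _ hxC, if_neg hY]
      simp
    · simp [hxC, hyC]

/-- Differences of pencil sums carry the `q`-Kneser operator on `k`-subspaces to a multiple of the
`q`-Kneser operator on the `(k-1)`-subspaces of the quotient by a line. -/
theorem pencilSum_kneserSum_sub (g : KSubspace F V k → ℝ) {B : KSubspace F V (k + 1)} {x y : V}
    (hx : x ≠ 0) (hy : y ∉ F ∙ x) (hxB : x ∈ B.1) (hyB : y ∈ B.1) :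
    pencilSum (fun W : KSubspace F V k => kneserSum g W.1) x B.1 -
        pencilSum (fun W : KSubspace F V k => kneserSum g W.1) y B.1 =
      -(flagCount F V k 1 2 (k + 1) : ℝ) *
        ∑ B' : KSubspace F V (k + 1) with B'.1 ⊓ B.1 = F ∙ x ⊔ F ∙ y,
          (pencilSum g x B'.1 - pencilSum g y B'.1) := by
  rw [Finset.sum_sub_distrib, sum_pencilSum, sum_pencilSum, pencilSum_kneserSum,
    pencilSum_kneserSum, ← Finset.sum_sub_distrib, ← Finset.sum_sub_distrib, Finset.mul_sum]
  refine Finset.sum_congr rfl fun C _ => ?_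
  rw [← mul_sub, card_pencil_sub_card_pencil C hx hy hxB hyB]
  ring

end KSubspace

end Intertwining

/-! ### Functions with equal pencil sums, and the maximum principle over `Q`. -/

section Rigidity

open scoped Classical
attribute [local instance] Fintype.ofFinite

variable {F V : Type*} [Field F] [Finite F] [AddCommGroup V] [Module F V] [FiniteDimensional F V]
  {k : ℕ}

namespace KSubspace

theorem pencilSum_smul (g : KSubspace F V k → ℝ) {c : F} (hc : c ≠ 0) (x : V)
    (B : Submodule F V) : pencilSum g (c • x) B = pencilSum g x B := by
  unfold pencilSum
  simp only [Submodule.smul_mem_iff _ hc]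

theorem card_filter_mem (W : Submodule F V) :
    haveI : Finite V := Module.finite_of_finite F
    Finset.card {x : V | x ∈ W} = Nat.card F ^ finrank F W := by
  have : Finite V := Module.finite_of_finite F
  rw [← Module.natCard_eq_pow_finrank, Nat.card_eq_fintype_card, Fintype.card_subtype]

/-- Point-hyperplane incidence in `B` is nonsingular: a function on the hyperplanes of `B` whose
sums over the hyperplanes through a point are all equal is constant. -/
theorem eq_of_pencilSum_eq (hk : 1 ≤ k) (g : KSubspace F V k → ℝ) (B : KSubspace F V (k + 1))
    (h : ∀ x ∈ B.1, ∀ y ∈ B.1, x ≠ 0 → y ≠ 0 → pencilSum g x B.1 = pencilSum g y B.1)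
    {W W' : KSubspace F V k} (hW : W.1 ≤ B.1) (hW' : W'.1 ≤ B.1) : g W = g W' := by
  have : Finite V := Module.finite_of_finite F
  obtain ⟨w, hwB, hw⟩ : ∃ w ∈ B.1, w ≠ 0 := Submodule.exists_mem_ne_zero_of_ne_bot fun h0 => by
    have := B.2
    rw [h0, finrank_bot] at this
    omega
  set c := pencilSum g w B.1
  -- The zero vector lies in every subspace, so its pencil sum runs over all hyperplanes of `B` and
  -- is treated separately from the common value `c`.
  set s := pencilSum g 0 B.1
  have hsum : ∀ U : KSubspace F V k, U.1 ≤ B.1 →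
      ∑ x : V with x ∈ U.1, pencilSum g x B.1 = (Nat.card F : ℝ) ^ k * c + (s - c) := by
    intro U hU
    have h1 : ∀ x ∈ ({x : V | x ∈ U.1} : Finset V),
        pencilSum g x B.1 = c + if x = 0 then s - c else 0 := by
      intro x hx
      split_ifs with h0
      · rw [h0]; ring
      · rw [add_zero]
        exact h x (hU (by simpa using hx)) w hwB h0 hw
    rw [Finset.sum_congr rfl h1, Finset.sum_add_distrib, Finset.sum_const, card_filter_mem, U.2,
      nsmul_eq_mul, Finset.sum_ite_eq', if_pos (by simp)]
    push_cast
    ring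
  -- Summing over `x ∈ U` first weights each hyperplane `C` by the size of `C ⊓ U`: `q ^ k` if `C =
  -- U`, and `q ^ (k - 1)` otherwise. The excess at `C = U` isolates `g U`.
  have hsum' : ∀ U : KSubspace F V k, U.1 ≤ B.1 →
      ∑ x : V with x ∈ U.1, pencilSum g x B.1 =
        (Nat.card F : ℝ) ^ (k - 1) * ∑ C : KSubspace F V k with C.1 ≤ B.1, g C +
          ((Nat.card F : ℝ) ^ k - (Nat.card F : ℝ) ^ (k - 1)) * g U := by
    intro U hU
    unfold pencilSum
    rw [Finset.sum_comm' (t' := {C : KSubspace F V k | C.1 ≤ B.1})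
      (s' := fun C => {x : V | x ∈ C.1 ⊓ U.1}) (by intro x C; simp; tauto)]
    have h1 : ∀ C ∈ ({C : KSubspace F V k | C.1 ≤ B.1} : Finset _),
        ∑ x : V with x ∈ C.1 ⊓ U.1, g C = (Nat.card F : ℝ) ^ (k - 1) * g C +
          if C = U then ((Nat.card F : ℝ) ^ k - (Nat.card F : ℝ) ^ (k - 1)) * g U else 0 := by
      intro C hC
      have hC : C.1 ≤ B.1 := by simpa using hC
      rw [Finset.sum_const, card_filter_mem, nsmul_eq_mul]
      split_ifs with h0
      · subst h0
        rw [inf_idem, C.2]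
        push_cast
        ring
      · have h2 := Submodule.finrank_sup_add_finrank_inf_eq C.1 U.1
        have h3 := Submodule.finrank_mono (sup_le hC hU)
        have h4 : finrank F (C.1 ⊓ U.1 : Submodule F V) ≠ k := fun h4 => h0 <| Subtype.ext <|
          (Submodule.eq_of_le_of_finrank_eq inf_le_left (h4.trans C.2.symm)).symm.trans
            (Submodule.eq_of_le_of_finrank_eq inf_le_right (h4.trans U.2.symm))
        have h5 := Submodule.finrank_mono (inf_le_left : C.1 ⊓ U.1 ≤ C.1)
        rw [C.2] at h2 h5
        rw [U.2] at h2
        rw [B.2] at h3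
        rw [show finrank F (C.1 ⊓ U.1 : Submodule F V) = k - 1 by omega]
        push_cast
        ring
    rw [Finset.sum_congr rfl h1, Finset.sum_add_distrib, ← Finset.mul_sum, Finset.sum_ite_eq',
      if_pos (by simpa using hU)]
  have hq : (1 : ℝ) < Nat.card F := by exact_mod_cast Finite.one_lt_card
  have hpow : (Nat.card F : ℝ) ^ (k - 1) < (Nat.card F : ℝ) ^ k :=
    pow_lt_pow_right₀ hq (by omega)
  have key := (hsum' W hW).symm.trans ((hsum W hW).trans ((hsum W' hW').symm.trans (hsum' W' hW')))
  exact mul_left_cancel₀ (sub_ne_zero.mpr hpow.ne') (add_left_cancel key)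

omit [Finite F] in
/-- A function on `k`-subspaces that is constant on the hyperplanes of every `(k+1)`-subspace is
constant. -/
theorem eq_of_forall_eq_of_le (g : KSubspace F V k → ℝ)
    (h : ∀ (B : KSubspace F V (k + 1)) (W W' : KSubspace F V k), W.1 ≤ B.1 → W'.1 ≤ B.1 →
      g W = g W') (W W' : KSubspace F V k) : g W = g W' := by
  obtain ⟨n, hn⟩ : ∃ n, n = k - finrank F (W.1 ⊓ W'.1 : Submodule F V) := ⟨_, rfl⟩
  induction n using Nat.strong_induction_on generalizing W with
  | _ n ih =>
    by_cases hWW : W'.1 ≤ W.1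
    · rw [Subtype.ext (Submodule.eq_of_le_of_finrank_eq hWW (W'.2.trans W.2.symm))]
    obtain ⟨x, hx', hx⟩ := SetLike.not_le_iff_exists.mp hWW
    have hlt : finrank F (W.1 ⊓ W'.1 : Submodule F V) < k := by
      refine lt_of_lt_of_eq (Submodule.finrank_lt_finrank_of_lt
        (lt_of_le_of_ne inf_le_right fun h => ?_)) W'.2
      exact hWW (inf_eq_right.mp h)
    -- Exchange step: a hyperplane `U` of `W` containing `W ⊓ W'`, together with `x ∈ W'` outside
    -- `W`, spans a `k`-subspace that shares more with `W'` and lies with `W` in one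
    -- `(k+1)`-subspace.
    obtain ⟨U, hUW, hU, hU', -⟩ := Submodule.exists_inf_eq_pair (W.1 ⊓ W'.1) (W.1 ⊓ W'.1)
      (W.1 ⊓ W'.1) W.1 (k - 1 - finrank F (W.1 ⊓ W'.1 : Submodule F V)) inf_le_left le_rfl le_rfl
      (by rw [W.2]; omega) (by rw [W.2]; omega)
    have hxU : x ∉ U := fun h => hx (hUW h)
    have hB := Submodule.finrank_sup_span_singleton hx
    have hW₂ := Submodule.finrank_sup_span_singleton hxU
    rw [W.2] at hB
    let W₂ : KSubspace F V k := ⟨U ⊔ F ∙ x, by omega⟩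
    rw [h ⟨W.1 ⊔ F ∙ x, hB⟩ W W₂ le_sup_left (sup_le_sup_right hUW _)]
    refine ih _ ?_ W₂ rfl
    have hle : (W.1 ⊓ W'.1) ⊔ F ∙ x ≤ W₂.1 ⊓ W'.1 := by
      refine le_inf (sup_le_sup_right (hU' ▸ inf_le_left) _) (sup_le inf_le_right ?_)
      exact (Submodule.span_singleton_le_iff_mem x _).mpr hx'
    have := Submodule.finrank_mono hle
    rw [Submodule.finrank_sup_span_singleton fun h => hx (Submodule.mem_inf.mp h).1] at this
    omega

theorem eq_of_forall_pencilSum_eq (hk : 1 ≤ k) (g : KSubspace F V k → ℝ)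
    (h : ∀ (B : KSubspace F V (k + 1)) (x y : V), x ≠ 0 → y ∉ F ∙ x → x ∈ B.1 → y ∈ B.1 →
      pencilSum g x B.1 = pencilSum g y B.1) (W W' : KSubspace F V k) : g W = g W' := by
  refine eq_of_forall_eq_of_le g (fun B W W' hW hW' => eq_of_pencilSum_eq hk g B ?_ hW hW') W W'
  intro x hx y hy hx0 hy0
  by_cases hyx : y ∈ F ∙ x
  · obtain ⟨c, rfl⟩ := Submodule.mem_span_singleton.mp hyx
    exact (pencilSum_smul g (fun hc => hy0 (by simp [hc])) x B.1).symm
  · exact h B x y hx0 hyx hx hy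

theorem sum_inf_eq_le (h : KSubspace F V (k + 1) → ℝ) {Q : Submodule F V} (hQ : finrank F Q = 2)
    {b : ℝ} (hb : ∀ B : KSubspace F V (k + 1), Q ≤ B.1 → h B ≤ b) {B : KSubspace F V (k + 1)}
    (hB : Q ≤ B.1) :
    ∑ B' : KSubspace F V (k + 1) with B'.1 ⊓ B.1 = Q, h B' ≤
      flagCount F V (k + 1) 2 (k + 1) (finrank F V) * b := by
  have h1 := card_inf_eq (k + 1) hB
  rw [hQ, B.2] at h1
  rw [← h1, ← nsmul_eq_mul]
  refine Finset.sum_le_card_nsmul _ _ _ fun B' hB' => hb B' ?_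
  have hB' : B'.1 ⊓ B.1 = Q := by simpa using hB'
  exact hB' ▸ inf_le_left

/-- An eigenvalue of the `q`-Kneser operator on the subspaces over `Q` is at most the degree. -/
theorem eq_zero_of_sum_inf_eq (h : KSubspace F V (k + 1) → ℝ) {Q : Submodule F V}
    (hQ : finrank F Q = 2) {r : ℝ}
    (hr : (flagCount F V (k + 1) 2 (k + 1) (finrank F V) : ℝ) < r)
    (heq : ∀ B : KSubspace F V (k + 1), Q ≤ B.1 →
      ∑ B' : KSubspace F V (k + 1) with B'.1 ⊓ B.1 = Q, h B' = r * h B)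
    (B : KSubspace F V (k + 1)) (hB : Q ≤ B.1) : h B = 0 := by
  have key : ∀ h : KSubspace F V (k + 1) → ℝ, (∀ B : KSubspace F V (k + 1), Q ≤ B.1 →
      ∑ B' : KSubspace F V (k + 1) with B'.1 ⊓ B.1 = Q, h B' = r * h B) → h B ≤ 0 := by
    intro h heq
    obtain ⟨B₀, hB₀, hmax⟩ := Finset.exists_max_image
      ({B : KSubspace F V (k + 1) | Q ≤ B.1} : Finset _) h ⟨B, by simpa using hB⟩
    simp only [Finset.mem_filter, Finset.mem_univ, true_and] at hB₀ hmax
    refine (hmax B hB).trans ?_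
    -- At a maximum `B₀` this reads `r * h B₀ ≤ d' * h B₀` with `d' < r`, so the maximum is not
    -- positive. Applied also to `-h`, it forces `h` to vanish over `Q`.
    have h1 := sum_inf_eq_le h hQ hmax hB₀
    rw [heq B₀ hB₀] at h1
    nlinarith
  refine le_antisymm (key h heq) ?_
  have := key (fun B => - h B) fun B hB => by
    rw [Finset.sum_neg_distrib, heq B hB, mul_neg]
  simpa using this

/-- A harmonic function for the `q`-Kneser operator on the subspaces over `Q` is constant. -/
theorem eq_of_sum_inf_eq (hk : 1 ≤ k) (hv : 2 * k ≤ finrank F V)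
    (h : KSubspace F V (k + 1) → ℝ) {Q : Submodule F V} (hQ : finrank F Q = 2)
    (heq : ∀ B : KSubspace F V (k + 1), Q ≤ B.1 →
      ∑ B' : KSubspace F V (k + 1) with B'.1 ⊓ B.1 = Q, h B' =
        flagCount F V (k + 1) 2 (k + 1) (finrank F V) * h B)
    (B B' : KSubspace F V (k + 1)) (hB : Q ≤ B.1) (hB' : Q ≤ B'.1) : h B = h B' := by
  obtain ⟨B₀, hB₀, hmax⟩ := Finset.exists_max_image
    ({B : KSubspace F V (k + 1) | Q ≤ B.1} : Finset _) h ⟨B, by simpa using hB⟩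
  simp only [Finset.mem_filter, Finset.mem_univ, true_and] at hB₀ hmax
  -- An average equal to the maximum has all its terms equal to the maximum, so the maximum spreads
  -- to neighbours.
  have step : ∀ B₁ B₂ : KSubspace F V (k + 1), Q ≤ B₁.1 → h B₁ = h B₀ → B₂.1 ⊓ B₁.1 = Q →
      h B₂ = h B₀ := by
    intro B₁ B₂ hB₁ h₁ h₂
    have hcard := card_inf_eq (k + 1) hB₁
    rw [hQ, B₁.2] at hcard
    have hsum : ∑ B' : KSubspace F V (k + 1) with B'.1 ⊓ B₁.1 = Q, h B' =
        ∑ B' : KSubspace F V (k + 1) with B'.1 ⊓ B₁.1 = Q, h B₀ := by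
      rw [heq B₁ hB₁, Finset.sum_const, hcard, nsmul_eq_mul, h₁]
    refine (Finset.sum_eq_sum_iff_of_le fun B' hB' => hmax B' ?_).mp hsum B₂ (by simpa using h₂)
    have hB' : B'.1 ⊓ B₁.1 = Q := by simpa using hB'
    exact hB' ▸ inf_le_left
  have all : ∀ B : KSubspace F V (k + 1), Q ≤ B.1 → h B = h B₀ := by
    intro B hB
    -- Any `B` over `Q` has a common neighbour with `B₀`, because `(k + 1) + (k - 1) ≤ dim V`.
    obtain ⟨X, -, hX, hXB, hXB₀⟩ := Submodule.exists_inf_eq_pair Q B.1 B₀.1 ⊤ (k - 1) le_top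
      hB hB₀ (by rw [B.2, finrank_top]; omega) (by rw [B₀.2, finrank_top]; omega)
    let B₁ : KSubspace F V (k + 1) := ⟨X, by omega⟩
    exact step B₁ B (hXB ▸ inf_le_left : Q ≤ X) (step B₀ B₁ hB₀ rfl hXB₀)
      (by rw [inf_comm]; exact hXB)
  rw [all B hB, all B' hB']

end KSubspace

end Rigidity

/-! ### The least eigenvalue, the ratio bound, and its attainment by stars. -/

section RatioBound

open scoped Classical
attribute [local instance] Fintype.ofFinite

variable {F V : Type*} [Field F] [Finite F] [AddCommGroup V] [Module F V] [FiniteDimensional F V]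
  {k : ℕ}

namespace KSubspace

variable (F V k) in
/-- The degree of the `q`-Kneser graph. -/
noncomputable def kneserDegree : ℝ := flagCount F V k 0 k (finrank F V)

variable (F V k) in
/-- The absolute value of the least eigenvalue of the `q`-Kneser graph. -/
noncomputable def kneserTau : ℝ :=
  flagCount F V k 1 2 (k + 1) * flagCount F V (k + 1) 2 (k + 1) (finrank F V)

theorem kneserDegree_nonneg : 0 ≤ kneserDegree F V k := Nat.cast_nonneg _

theorem kneserTau_nonneg : 0 ≤ kneserTau F V k := mul_nonneg (Nat.cast_nonneg _) (Nat.cast_nonneg _)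

theorem card_inf_eq_bot (W : KSubspace F V k) :
    (Finset.card {C : KSubspace F V k | C.1 ⊓ W.1 = ⊥} : ℝ) = kneserDegree F V k := by
  have h := card_inf_eq k (bot_le : ⊥ ≤ W.1)
  rw [finrank_bot, W.2] at h
  rw [h, kneserDegree]

theorem sum_kneserSum (g : KSubspace F V k → ℝ) :
    ∑ W : KSubspace F V k, kneserSum g W.1 = kneserDegree F V k * ∑ W, g W := by
  unfold kneserSum
  rw [Finset.sum_comm' (t' := Finset.univ)
    (s' := fun C : KSubspace F V k => {W : KSubspace F V k | W.1 ⊓ C.1 = ⊥})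
    (by intro W C; simp [inf_comm]), Finset.mul_sum]
  refine Finset.sum_congr rfl fun C _ => ?_
  rw [Finset.sum_const, nsmul_eq_mul, card_inf_eq_bot]

theorem pencilSum_add (g g' : KSubspace F V k → ℝ) (x : V) (B : Submodule F V) :
    pencilSum (fun W => g W + g' W) x B = pencilSum g x B + pencilSum g' x B :=
  Finset.sum_add_distrib

theorem pencilSum_const_mul (c : ℝ) (g : KSubspace F V k → ℝ) (x : V) (B : Submodule F V) :
    pencilSum (fun W => c * g W) x B = c * pencilSum g x B :=
  (Finset.mul_sum _ _ _).symm

theorem pencilSum_const {B : KSubspace F V (k + 1)} (c : ℝ) {x : V} (hx : x ≠ 0) (hxB : x ∈ B.1) :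
    pencilSum (fun _ : KSubspace F V k => c) x B.1 = flagCount F V k 1 1 (k + 1) * c := by
  rw [pencilSum, Finset.sum_const, nsmul_eq_mul, card_mem_le hx hxB B.2]

/-- Every eigenvector of the `q`-Kneser graph orthogonal to the constants has an eigenvalue of at
least `-kneserTau`. -/
theorem eq_zero_of_kneserSum_eq (hk : 1 ≤ k) (g : KSubspace F V k → ℝ) {r : ℝ}
    (hr : r < -kneserTau F V k) (heq : ∀ W : KSubspace F V k, kneserSum g W.1 = r * g W)
    (hsum : ∑ W, g W = 0) (W : KSubspace F V k) : g W = 0 := by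
  have hconst := eq_of_forall_pencilSum_eq hk g fun B x y hx hy hxB hyB => by
    have ha : (0 : ℝ) < flagCount F V k 1 2 (k + 1) := by
      exact_mod_cast flagCount_pos hk hx hy hxB hyB B.2
    -- By the intertwining identity the differences have eigenvalue `-r / a` over `Q`, which exceeds
    -- the degree `d'`.
    refine sub_eq_zero.mp (eq_zero_of_sum_inf_eq (fun B => pencilSum g x B.1 - pencilSum g y B.1)
      (Submodule.finrank_span_pair hx hy) (r := -r / flagCount F V k 1 2 (k + 1)) ?_ ?_ B
      (sup_le ((Submodule.span_singleton_le_iff_mem x _).mpr hxB)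
        ((Submodule.span_singleton_le_iff_mem y _).mpr hyB)))
    · rw [lt_div_iff₀ ha]
      rw [kneserTau] at hr
      linarith
    · intro B hB
      rw [sup_le_iff, Submodule.span_singleton_le_iff_mem, Submodule.span_singleton_le_iff_mem]
        at hB
      have h := pencilSum_kneserSum_sub g hx hy hB.1 hB.2
      simp only [heq, pencilSum_const_mul] at h
      field_simp
      linarith
  have h0 : ∑ W', g W' = ∑ _W' : KSubspace F V k, g W :=
    Finset.sum_congr rfl fun W' _ => hconst W' W
  rw [hsum, Finset.sum_const, nsmul_eq_mul, eq_comm, mul_eq_zero] at h0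
  refine h0.resolve_left ?_
  have : Nonempty (KSubspace F V k) := ⟨W⟩
  simp

variable (F V k) in
/-- The positive semidefinite matrix of the ratio bound. -/
noncomputable def ratioMatrix : Matrix (KSubspace F V k) (KSubspace F V k) ℝ :=
  Matrix.of fun W C => (if C.1 ⊓ W.1 = ⊥ then 1 else 0) + (if W = C then kneserTau F V k else 0) -
    (kneserDegree F V k + kneserTau F V k) / Fintype.card (KSubspace F V k)

theorem ratioMatrix_mulVec (g : KSubspace F V k → ℝ) (W : KSubspace F V k) :
    (ratioMatrix F V k).mulVec g W = kneserSum g W.1 + kneserTau F V k * g W -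
      (kneserDegree F V k + kneserTau F V k) / Fintype.card (KSubspace F V k) * ∑ C, g C := by
  simp only [Matrix.mulVec, dotProduct, ratioMatrix, Matrix.of_apply, sub_mul, add_mul,
    Finset.sum_sub_distrib, Finset.sum_add_distrib, ite_mul, one_mul, zero_mul,
    Finset.sum_ite_eq, Finset.mem_univ, if_true, ← Finset.mul_sum, kneserSum, Finset.sum_filter]

/-- The constant subtracted in `ratioMatrix` is chosen to make the column sums zero. Hence an
eigenvector with nonzero eigenvalue has sum zero. -/
theorem sum_ratioMatrix_mulVec [Nonempty (KSubspace F V k)] (g : KSubspace F V k → ℝ) :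
    ∑ W, (ratioMatrix F V k).mulVec g W = 0 := by
  simp only [ratioMatrix_mulVec, Finset.sum_sub_distrib, Finset.sum_add_distrib, sum_kneserSum,
    ← Finset.mul_sum, Finset.sum_const, nsmul_eq_mul, Finset.card_univ]
  have : (Fintype.card (KSubspace F V k) : ℝ) ≠ 0 := by
    exact_mod_cast Fintype.card_ne_zero
  field_simp
  ring

theorem ratioMatrix_isHermitian : (ratioMatrix F V k).IsHermitian := by
  ext W C
  simp only [ratioMatrix, Matrix.conjTranspose_apply, Matrix.of_apply, star_trivial, inf_comm,
    eq_comm]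

theorem ratioMatrix_posSemidef [Nonempty (KSubspace F V k)] (hk : 1 ≤ k) :
    (ratioMatrix F V k).PosSemidef := by
  rw [ratioMatrix_isHermitian.posSemidef_iff_eigenvalues_nonneg]
  intro i
  by_contra hneg
  rw [Pi.zero_apply, not_le] at hneg
  set μ := (ratioMatrix_isHermitian (F := F) (V := V) (k := k)).eigenvalues i
  set e := (ratioMatrix_isHermitian (F := F) (V := V) (k := k)).eigenvectorBasis i with he
  have hg : ∀ W, (ratioMatrix F V k).mulVec e W = μ * e W := fun W =>
    congrFun (ratioMatrix_isHermitian.mulVec_eigenvectorBasis i) W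
  have hsum : ∑ W, e W = 0 := by
    have h := sum_ratioMatrix_mulVec (F := F) (V := V) (k := k) e
    simp only [hg, ← Finset.mul_sum] at h
    exact (mul_eq_zero.mp h).resolve_left hneg.ne
  have h0 := eq_zero_of_kneserSum_eq hk (fun W => e W) (r := μ - kneserTau F V k) (by linarith)
    (fun W => by
      have h := hg W
      rw [ratioMatrix_mulVec, hsum] at h
      linarith) hsum
  exact (ratioMatrix_isHermitian (F := F) (V := V) (k := k)).eigenvectorBasis.orthonormal.ne_zero i
    (by ext W; exact h0 W)

/-- The indicator function of the `k`-subspaces containing a vector. -/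
noncomputable def starIndicator (x : V) (W : KSubspace F V k) : ℝ := if x ∈ W.1 then 1 else 0

theorem pencilSum_starIndicator_sub {B : KSubspace F V (k + 1)} {x y : V} (hx : x ≠ 0)
    (hy : y ∉ F ∙ x) (hxB : x ∈ B.1) (hyB : y ∈ B.1) :
    pencilSum (starIndicator (k := k) x) x B.1 - pencilSum (starIndicator (k := k) x) y B.1 =
      flagCount F V k 1 2 (k + 1) := by
  unfold pencilSum starIndicator
  rw [← card_mem_notMem_le hx hy hxB hyB B.2, Finset.sum_filter, Finset.sum_filter,
    ← Finset.sum_sub_distrib, Finset.card_filter, Nat.cast_sum]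
  refine Finset.sum_congr rfl fun C _ => ?_
  by_cases h1 : x ∈ C.1 <;> by_cases h2 : y ∈ C.1 <;> by_cases h3 : C.1 ≤ B.1 <;> simp [h1, h2, h3]

theorem kneserSum_starIndicator {x : V} (hx : x ≠ 0) (W : KSubspace F V k) :
    kneserSum (starIndicator (k := k) x) W.1 =
      flagCount F V k 1 (k + 1) (finrank F V) * (1 - starIndicator x W) := by
  unfold kneserSum starIndicator
  rw [← Finset.sum_filter, Finset.filter_filter, Finset.sum_const, nsmul_eq_mul, mul_one]
  split_ifs with hxW
  · rw [sub_self, mul_zero, Nat.cast_eq_zero, Finset.card_eq_zero, Finset.filter_eq_empty_iff]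
    rintro C - ⟨hC, hxC⟩
    exact hx ((Submodule.mem_bot F).mp (hC.le ⟨hxC, hxW⟩))
  · rw [← card_mem_inf_eq_bot hxW W.2, sub_zero, mul_one]
    simp only [and_comm]

/-- No explicit count is needed: the intertwining identity is applied to a star. All its differences
over `Q` equal `a`, while `A` multiplies them by minus the left-hand count, so `a` times that count
is `a * d' * a`. -/
theorem flagCount_eq_kneserTau (hk : 1 ≤ k) (hv : 2 * k < finrank F V) :
    (flagCount F V k 1 (k + 1) (finrank F V) : ℝ) = kneserTau F V k := by
  obtain ⟨x, -, hx⟩ : ∃ x ∈ (⊤ : Submodule F V), x ≠ 0 :=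
    Submodule.exists_mem_ne_zero_of_ne_bot fun h => by
      rw [← finrank_top, h, finrank_bot] at hv
      omega
  obtain ⟨y, -, hy⟩ := SetLike.not_le_iff_exists.mp
    (Submodule.not_le_of_finrank_lt (U := F ∙ x) (W := ⊤)
      (by rw [finrank_span_singleton hx, finrank_top]; omega))
  have hQ := Submodule.finrank_span_pair hx hy
  obtain ⟨X, -, hX, hXQ, -⟩ := Submodule.exists_inf_eq_pair (F ∙ x ⊔ F ∙ y) (F ∙ x ⊔ F ∙ y)
    (F ∙ x ⊔ F ∙ y) ⊤ (k - 1) le_top le_rfl le_rfl (by rw [hQ, finrank_top]; omega)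
    (by rw [hQ, finrank_top]; omega)
  let B : KSubspace F V (k + 1) := ⟨X, by omega⟩
  have hQB : F ∙ x ⊔ F ∙ y ≤ B.1 := inf_eq_right.mp hXQ
  have mem_of_le : ∀ B : KSubspace F V (k + 1), F ∙ x ⊔ F ∙ y ≤ B.1 → x ∈ B.1 ∧ y ∈ B.1 := by
    intro B hB
    rwa [sup_le_iff, Submodule.span_singleton_le_iff_mem, Submodule.span_singleton_le_iff_mem]
      at hB
  obtain ⟨hxB, hyB⟩ := mem_of_le B hQB
  have hy0 : y ≠ 0 := fun h => hy (h ▸ Submodule.zero_mem _)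
  have ha : (0 : ℝ) < flagCount F V k 1 2 (k + 1) := by
    exact_mod_cast flagCount_pos hk hx hy hxB hyB B.2
  have h := pencilSum_kneserSum_sub (starIndicator (k := k) x) hx hy hxB hyB
  have hsum : ∑ B' : KSubspace F V (k + 1) with B'.1 ⊓ B.1 = F ∙ x ⊔ F ∙ y,
      (pencilSum (starIndicator (k := k) x) x B'.1 - pencilSum (starIndicator (k := k) x) y B'.1) =
      flagCount F V (k + 1) 2 (k + 1) (finrank F V) * flagCount F V k 1 2 (k + 1) := by
    have hcard := card_inf_eq (k + 1) hQB
    rw [hQ, B.2] at hcard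
    rw [← hcard, ← nsmul_eq_mul, ← Finset.sum_const]
    refine Finset.sum_congr rfl fun B' hB' => ?_
    have hB' : B'.1 ⊓ B.1 = F ∙ x ⊔ F ∙ y := by simpa using hB'
    obtain ⟨h1, h2⟩ := mem_of_le B' (hB' ▸ inf_le_left)
    exact pencilSum_starIndicator_sub hx hy h1 h2
  have hfun : (fun W : KSubspace F V k => kneserSum (starIndicator (k := k) x) W.1) =
      fun W => (flagCount F V k 1 (k + 1) (finrank F V) : ℝ) +
        -(flagCount F V k 1 (k + 1) (finrank F V) : ℝ) * starIndicator x W := by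
    funext W
    rw [kneserSum_starIndicator hx]
    ring
  rw [hsum, hfun, pencilSum_add, pencilSum_add, pencilSum_const _ hx hxB,
    pencilSum_const _ hy0 hyB, pencilSum_const_mul, pencilSum_const_mul, add_sub_add_left_eq_sub,
    ← mul_sub, pencilSum_starIndicator_sub hx hy hxB hyB] at h
  refine mul_right_cancel₀ ha.ne' ?_
  rw [kneserTau]
  linarith

/-- The star of a vector attains the ratio bound. -/
theorem kneserDegree_add_kneserTau_mul_sum_starIndicator (hk : 1 ≤ k) (hv : 2 * k < finrank F V)
    {x : V} (hx : x ≠ 0) :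
    (kneserDegree F V k + kneserTau F V k) * ∑ W : KSubspace F V k, starIndicator x W =
      kneserTau F V k * Fintype.card (KSubspace F V k) := by
  have h := sum_kneserSum (starIndicator (k := k) (F := F) x)
  simp only [kneserSum_starIndicator hx, flagCount_eq_kneserTau hk hv, ← Finset.mul_sum,
    Finset.sum_sub_distrib, Finset.sum_const, nsmul_eq_mul, Finset.card_univ, mul_one] at h
  linarith

end KSubspace

end RatioBound

/-! ### Equality in the ratio bound and the common vector. -/

section MaximumIndependentSets

open scoped Classical
attribute [local instance] Fintype.ofFinite

variable {F V : Type*} [Field F] [Finite F] [AddCommGroup V] [Module F V] [FiniteDimensional F V]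
  {k : ℕ}

namespace KSubspace

/-- The indicator function of a set of `k`-subspaces. -/
noncomputable def setIndicator (S : Finset (KSubspace F V k)) (W : KSubspace F V k) : ℝ :=
  if W ∈ S then 1 else 0

theorem sum_setIndicator (S : Finset (KSubspace F V k)) : ∑ W, setIndicator S W = S.card := by
  simp [setIndicator]

omit [Finite F] [FiniteDimensional F V] in
theorem inf_ne_bot_of_isIndepSet (hk : 1 ≤ k) {S : Finset (KSubspace F V k)}
    (hS : (qKneserGraph F V k).IsIndepSet S) {W C : KSubspace F V k} (hW : W ∈ S) (hC : C ∈ S) :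
    W.1 ⊓ C.1 ≠ ⊥ := by
  intro h
  by_cases hWC : W = C
  · subst hWC
    have := W.2
    rw [inf_idem] at h
    rw [h, finrank_bot] at this
    omega
  · exact hS hW hC hWC ⟨hWC, h⟩

variable (F k) in
theorem isIndepSet_star {x : V} (hx : x ≠ 0) :
    (qKneserGraph F V k).IsIndepSet
      (({W : KSubspace F V k | x ∈ W.1} : Finset (KSubspace F V k)) : Set (KSubspace F V k)) := by
  intro W hW C hC _ hadj
  simp only [Finset.coe_filter, Finset.mem_univ, true_and, Set.mem_ofPred_eq] at hW hC
  exact hx ((Submodule.mem_bot F).mp (hadj.2.le ⟨hW, hC⟩))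

theorem sum_starIndicator (x : V) : ∑ W : KSubspace F V k, starIndicator x W =
    (Finset.card {W : KSubspace F V k | x ∈ W.1} : ℝ) := by
  simp [starIndicator]

/-- The indicator function of a maximum independent set lies in the sum of the constants and the
eigenspace of the least eigenvalue. -/
theorem exists_kneserSum_setIndicator_add_eq (hk : 1 ≤ k) (hv : 2 * k < finrank F V)
    {S : Finset (KSubspace F V k)} (hS : (qKneserGraph F V k).IsMaximumIndepSet S) :
    ∃ c : ℝ, ∀ W : KSubspace F V k,
      kneserSum (setIndicator S) W.1 + kneserTau F V k * setIndicator S W = c := by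
  by_cases hne : Nonempty (KSubspace F V k)
  swap
  · exact ⟨0, fun W => absurd ⟨W⟩ hne⟩
  obtain ⟨x, -, hx⟩ : ∃ x ∈ (⊤ : Submodule F V), x ≠ 0 :=
    Submodule.exists_mem_ne_zero_of_ne_bot fun h => by
      rw [← finrank_top, h, finrank_bot] at hv
      omega
  have hstar := kneserDegree_add_kneserTau_mul_sum_starIndicator hk hv hx
  have hle := hS.maximum _ (isIndepSet_star F k hx)
  have hle' : (∑ W : KSubspace F V k, starIndicator x W) ≤ (S.card : ℝ) := by
    rw [sum_starIndicator]
    exact_mod_cast hle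
  have hn : (0 : ℝ) < Fintype.card (KSubspace F V k) := by exact_mod_cast Fintype.card_pos
  -- Independence kills the adjacency part of the quadratic form. Since `S` is at least as large as
  -- a star, the remaining value is not positive; semidefiniteness then puts the indicator in the
  -- kernel.
  have hquad : setIndicator S ⬝ᵥ (ratioMatrix F V k).mulVec (setIndicator S) =
      kneserTau F V k * S.card - (kneserDegree F V k + kneserTau F V k) /
        Fintype.card (KSubspace F V k) * S.card * S.card := by
    have hterm : ∀ W : KSubspace F V k,
        setIndicator S W * (ratioMatrix F V k).mulVec (setIndicator S) W =
        (kneserTau F V k - (kneserDegree F V k + kneserTau F V k) /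
          Fintype.card (KSubspace F V k) * S.card) * setIndicator S W := by
      intro W
      rw [ratioMatrix_mulVec, sum_setIndicator]
      by_cases hW : W ∈ S
      · have h0 : kneserSum (setIndicator S) W.1 = 0 := by
          refine Finset.sum_eq_zero fun C hC => ?_
          have hC : C.1 ⊓ W.1 = ⊥ := by simpa using hC
          exact if_neg fun hCS => inf_ne_bot_of_isIndepSet hk hS.isIndepSet hCS hW hC
        rw [h0]
        simp [setIndicator, hW]
      · simp [setIndicator, hW]
    simp only [dotProduct, hterm, ← Finset.mul_sum, sum_setIndicator]
    ring
  have hpsd := ratioMatrix_posSemidef (F := F) (V := V) hk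
  have hzero : (ratioMatrix F V k).mulVec (setIndicator S) = 0 := by
    rw [← hpsd.dotProduct_mulVec_zero_iff, star_trivial]
    refine le_antisymm ?_ ?_
    · rw [hquad, div_mul_eq_mul_div, div_mul_eq_mul_div, sub_nonpos, le_div_iff₀ hn]
      have h1 := mul_le_mul_of_nonneg_left hle'
        (add_nonneg (kneserDegree_nonneg (F := F) (V := V) (k := k))
          (kneserTau_nonneg (F := F) (V := V) (k := k)))
      rw [hstar] at h1
      nlinarith [mul_le_mul_of_nonneg_right h1 (Nat.cast_nonneg (α := ℝ) S.card)]
    · simpa using hpsd.dotProduct_mulVec_nonneg (setIndicator S)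
  refine ⟨(kneserDegree F V k + kneserTau F V k) / Fintype.card (KSubspace F V k) *
    ∑ C, setIndicator S C, fun W => ?_⟩
  have h := congrFun hzero W
  rw [ratioMatrix_mulVec, Pi.zero_apply] at h
  exact sub_eq_zero.mp h

/-- For a maximum independent set, the difference of the pencil sums at two points does not depend
on the `(k+1)`-subspace through these points. -/
theorem pencilSum_setIndicator_sub_eq (hk : 1 ≤ k) (hv : 2 * k < finrank F V)
    {S : Finset (KSubspace F V k)} (hS : (qKneserGraph F V k).IsMaximumIndepSet S) {x y : V}
    (hx : x ≠ 0) (hy : y ∉ F ∙ x) (B B' : KSubspace F V (k + 1))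
    (hB : F ∙ x ⊔ F ∙ y ≤ B.1) (hB' : F ∙ x ⊔ F ∙ y ≤ B'.1) :
    pencilSum (setIndicator S) x B.1 - pencilSum (setIndicator S) y B.1 =
      pencilSum (setIndicator S) x B'.1 - pencilSum (setIndicator S) y B'.1 := by
  obtain ⟨c, hc⟩ := exists_kneserSum_setIndicator_add_eq hk hv hS
  have hy0 : y ≠ 0 := fun h => hy (h ▸ Submodule.zero_mem _)
  refine eq_of_sum_inf_eq hk hv.le (fun B : KSubspace F V (k + 1) =>
    pencilSum (setIndicator S) x B.1 - pencilSum (setIndicator S) y B.1)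
    (Submodule.finrank_span_pair hx hy) (fun B hB => ?_) B B' hB hB'
  rw [sup_le_iff, Submodule.span_singleton_le_iff_mem, Submodule.span_singleton_le_iff_mem] at hB
  have ha : (0 : ℝ) < flagCount F V k 1 2 (k + 1) := by
    exact_mod_cast flagCount_pos hk hx hy hB.1 hB.2 B.2
  have h := pencilSum_kneserSum_sub (setIndicator S) hx hy hB.1 hB.2
  have hfun : (fun W : KSubspace F V k => kneserSum (setIndicator S) W.1) =
      fun W => c + -kneserTau F V k * setIndicator S W := by
    funext W
    linarith [hc W]
  rw [hfun, pencilSum_add, pencilSum_add, pencilSum_const _ hx hB.1, pencilSum_const _ hy0 hB.2,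
    pencilSum_const_mul, pencilSum_const_mul, kneserTau] at h
  refine mul_left_cancel₀ ha.ne' ?_
  linarith

/-- Pencil sums agree at any two points that some member of the maximum independent set avoids. -/
theorem pencilSum_setIndicator_eq_of_notMem (hk : 1 ≤ k) (hv : 2 * k < finrank F V)
    {S : Finset (KSubspace F V k)} (hS : (qKneserGraph F V k).IsMaximumIndepSet S)
    {W : KSubspace F V k} (hW : W ∈ S) {x y : V} (hx : x ∉ W.1) (hy : y ∉ W.1)
    (B : KSubspace F V (k + 1)) (hxB : x ∈ B.1) (hyB : y ∈ B.1) :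
    pencilSum (setIndicator S) x B.1 = pencilSum (setIndicator S) y B.1 := by
  have hx0 : x ≠ 0 := fun h => hx (h ▸ W.1.zero_mem)
  by_cases hyx : y ∈ F ∙ x
  · obtain ⟨c, rfl⟩ := Submodule.mem_span_singleton.mp hyx
    exact (pencilSum_smul _ (fun hc => hy (by simp [hc])) x B.1).symm
  have hQ := Submodule.finrank_span_pair hx0 hyx
  have hWQ : finrank F (W.1 ⊔ (F ∙ x ⊔ F ∙ y) : Submodule F V) ≤ k + 2 := by
    have := Submodule.finrank_add_le_finrank_add_finrank W.1 (F ∙ x ⊔ F ∙ y)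
    rwa [W.2, hQ] at this
  -- General position needs `(k + 2) + (k - 1) ≤ dim V`, which is exactly `2 * k < dim V`.
  obtain ⟨X, -, hX, hXW, -⟩ := Submodule.exists_inf_eq_pair (F ∙ x ⊔ F ∙ y)
    (W.1 ⊔ (F ∙ x ⊔ F ∙ y)) (W.1 ⊔ (F ∙ x ⊔ F ∙ y)) ⊤ (k - 1) le_top le_sup_right le_sup_right
    (by rw [finrank_top]; omega) (by rw [finrank_top]; omega)
  let B' : KSubspace F V (k + 1) := ⟨X, by omega⟩
  have hQB : F ∙ x ⊔ F ∙ y ≤ B.1 :=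
    sup_le ((Submodule.span_singleton_le_iff_mem x _).mpr hxB)
      ((Submodule.span_singleton_le_iff_mem y _).mpr hyB)
  have hQB' : F ∙ x ⊔ F ∙ y ≤ B'.1 := hXW ▸ inf_le_left
  rw [← sub_eq_zero, pencilSum_setIndicator_sub_eq hk hv hS hx0 hyx B B' hQB hQB', sub_eq_zero]
  have key : ∀ C : KSubspace F V k, C ∈ S → C.1 ≤ B'.1 → ∃ z ∈ C.1, z ∈ W.1 ∧ z ≠ 0 ∧
      ∃ a b : F, z = a • x + b • y := by
    intro C hC hCB
    obtain ⟨z, hz, hz0⟩ := Submodule.exists_mem_ne_zero_of_ne_bot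
      (inf_ne_bot_of_isIndepSet hk hS.isIndepSet hC hW)
    refine ⟨z, hz.1, hz.2, hz0, ?_⟩
    have hzQ : z ∈ F ∙ x ⊔ F ∙ y := hXW.le ⟨hCB hz.1, Submodule.mem_sup_left hz.2⟩
    obtain ⟨u, hu, w, hw, rfl⟩ := Submodule.mem_sup.mp hzQ
    obtain ⟨a, rfl⟩ := Submodule.mem_span_singleton.mp hu
    obtain ⟨b, rfl⟩ := Submodule.mem_span_singleton.mp hw
    exact ⟨a, b, rfl⟩
  -- A member `C ≤ B'` of `S` meets `W` in some `a • x + b • y`. Both coefficients are nonzero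
  -- because `x, y ∉ W`, so `C` contains both of `x`, `y` or neither.
  have hiff : ∀ C : KSubspace F V k, C ∈ S → C.1 ≤ B'.1 → (x ∈ C.1 ↔ y ∈ C.1) := by
    intro C hC hCB
    obtain ⟨z, hzC, hzW, hz0, a, b, rfl⟩ := key C hC hCB
    have ha : a ≠ 0 := by
      rintro rfl
      have hb : b ≠ 0 := by
        rintro rfl
        simp at hz0
      exact hy ((Submodule.smul_mem_iff _ hb).mp (by simpa using hzW))
    have hb : b ≠ 0 := by
      rintro rfl
      exact hx ((Submodule.smul_mem_iff _ ha).mp (by simpa using hzW))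
    constructor
    · intro h
      exact (Submodule.smul_mem_iff _ hb).mp
        ((C.1.add_mem_iff_right (C.1.smul_mem a h)).mp hzC)
    · intro h
      exact (Submodule.smul_mem_iff _ ha).mp
        ((C.1.add_mem_iff_left (C.1.smul_mem b h)).mp hzC)
  unfold pencilSum
  rw [Finset.sum_filter, Finset.sum_filter]
  refine Finset.sum_congr rfl fun C _ => ?_
  by_cases hC : C ∈ S
  · by_cases hCB : C.1 ≤ B'.1
    · simp only [hiff C hC hCB]
    · simp only [hCB, and_false]
  · simp [setIndicator, hC]

/-- The members of a maximum independent set have a nonzero vector in common. -/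
theorem exists_forall_mem_of_isMaximumIndepSet (hk : 1 ≤ k) (hv : 2 * k < finrank F V)
    {S : Finset (KSubspace F V k)} (hS : (qKneserGraph F V k).IsMaximumIndepSet S) :
    ∃ x : V, x ≠ 0 ∧ ∀ W ∈ S, x ∈ W.1 := by
  by_contra! hcon
  have hconst := eq_of_forall_pencilSum_eq hk (setIndicator S) fun B x y hx hy hxB hyB => by
    have hy0 : y ≠ 0 := fun h => hy (h ▸ Submodule.zero_mem _)
    obtain ⟨W₁, hW₁, hx₁⟩ := hcon x hx
    obtain ⟨W₂, hW₂, hy₂⟩ := hcon y hy0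
    -- No single member of `S` need avoid both `x` and `y`; a point `z` of `B` outside `W₁` and `W₂`
    -- links the two pencil sums.
    obtain ⟨z, hzB, hz₁, hz₂⟩ := Submodule.exists_notMem_of_not_le (B := B.1)
      (Submodule.not_le_of_finrank_lt (U := W₁.1) (by rw [W₁.2, B.2]; omega))
      (Submodule.not_le_of_finrank_lt (U := W₂.1) (by rw [W₂.2, B.2]; omega))
    rw [pencilSum_setIndicator_eq_of_notMem hk hv hS hW₁ hx₁ hz₁ B hxB hzB,
      pencilSum_setIndicator_eq_of_notMem hk hv hS hW₂ hz₂ hy₂ B hzB hyB]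
  obtain ⟨x, -, hx⟩ : ∃ x ∈ (⊤ : Submodule F V), x ≠ 0 :=
    Submodule.exists_mem_ne_zero_of_ne_bot fun h => by
      rw [← finrank_top, h, finrank_bot] at hv
      omega
  obtain ⟨W, hW, -⟩ := hcon x hx
  -- A constant indicator puts every `k`-subspace in `S`, including one that meets `W` trivially.
  obtain ⟨X, -, hX, hXW, -⟩ := Submodule.exists_disjoint_pair W.1 W.1 ⊤ k
    (by rw [W.2, finrank_top]; omega) (by rw [W.2, finrank_top]; omega)
  have h := hconst W ⟨X, hX⟩
  have hXS : (⟨X, hX⟩ : KSubspace F V k) ∈ S := by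
    by_contra hXS
    simp [setIndicator, hW, hXS] at h
  exact inf_ne_bot_of_isIndepSet hk hS.isIndepSet hXS hW hXW

end KSubspace

end MaximumIndependentSets

theorem mainTheorem3 {F V : Type*} [Field F] [Finite F] [AddCommGroup V] [Module F V]
    [FiniteDimensional F V] (v k : ℕ) (hv : Module.finrank F V = v) (hk : 1 ≤ k)
    (hvk : 2 * k < v) (S : Finset (KSubspace F V k))
    (hS : (qKneserGraph F V k).IsMaximumIndepSet S) :
    ∃ L : Submodule F V, Module.finrank F L = 1 ∧
      ∀ α : KSubspace F V k, α ∈ S ↔ L ≤ α.1 := by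
  classical
  obtain ⟨x, hx, hxS⟩ := KSubspace.exists_forall_mem_of_isMaximumIndepSet hk (hv ▸ hvk) hS
  refine ⟨Submodule.span F {x}, finrank_span_singleton hx, fun α => ?_⟩
  rw [Submodule.span_singleton_le_iff_mem]
  refine ⟨hxS α, fun hα => ?_⟩
  -- Subspaces sharing `x` are never adjacent, so a further subspace through `x` could be added to
  -- `S`, against maximality.
  have hins : (qKneserGraph F V k).IsIndepSet
      ((insert α S : Finset (KSubspace F V k)) : Set (KSubspace F V k)) := by
    intro W hW C hC _ hadj
    have hmem : ∀ U ∈ insert α S, x ∈ U.1 := by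
      intro U hU
      rcases Finset.mem_insert.mp hU with rfl | hU
      · exact hα
      · exact hxS U hU
    exact hx ((Submodule.mem_bot F).mp
      (hadj.2.le ⟨hmem W (Finset.mem_coe.mp hW), hmem C (Finset.mem_coe.mp hC)⟩))
  by_contra hαS
  have := hS.maximum _ hins
  rw [Finset.card_insert_of_notMem hαS] at this
  omega
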